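/- Let $\mathbb P_T$, $\mathbb P_R$ be probability distributions on $\mathbb R^d$ and let $a:[0,\infty)\to[0,\infty)$ be an attenuation function. Fix positions $T_1,\dots,T_n\in\mathbb R^d$ of $n$ transmitters and $R_1,\dots,R_n\in\mathbb R^d$ of $n$ receivers, and put $\mathrm{SNR}_i=a(\|T_i-R_i\|)$ and $\mathrm{INR}_{ij}=a(\|T_i-R_j\|)$ for $i\ne j$ (so the first index is the transmitter and the second the receiver). Let $S_{ii}=\tfrac12\log(1+2\,\mathrm{SNR}_i)$, $S_{ij}=\tfrac12\log(1+2\,\mathrm{INR}_{ij})$ for $i\neq j$, and $E=\tfrac12\,\mathbb E\log(1+2a(\|T-R\|))$, where $T\sim\mathbb P_T$ and $R\sim\mathbb P_R$ are independent; this expectation is assumed to be finite. Logarithms are natural. In the $n$-user Gaussian interference network, transmitter $i$ sends complex numbers $x_i[1],\dots,x_i[N]$ with $\frac1N\sum_{t}|x_i[t]|^2\le1$, and receiver $j$ receives $$Y_j[t]=e^{\mathrm i\Theta_{jj}[t]}\sqrt{\mathrm{SNR}_j}\,x_j[t]+\sum_{i\ne j}e^{\mathrm i\Theta_{ij}[t]}\sqrt{\mathrm{INR}_{ij}}\,x_i[t]+Z_j[t],$$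 where the noise terms $Z_j[t]$ are independent standard complex Gaussian random variables and the phases $\Theta_{ij}[t]$ are independent, uniform on $[0,2\pi]$ and independent of the noise. At time $t$ every transmitter and every receiver knows all phases up to time $t$. Rates $r_1,\dots,r_n$ (in nats per channel use) are jointly achievable if for every $\delta>0$ and all sufficiently large block lengths $N$ there is a code in which each user $i$ has at least $e^{Nr_i}$ messages and in which, for independent uniformly distributed messages, each receiver decodes its own message with error probability at most $\delta$. Let $\epsilon$ be a real number and $i\ne j$, and suppose that the crosslink $i\to j$ is an $\epsilon$-bottleneck link: $$S_{ii}\le E+\epsilon/2,\qquad S_{ji}\le E+\epsilon/2,\qquad S_{jj}\le S_{ji}.$$ Then any jointly achievable rates satisfy $r_i+r_j\le 2E+\epsilon$. -/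

import Mathlib

open MeasureTheory ProbabilityTheory Filter

noncomputable section

namespace GaussianInterference

/-- The power gain from transmitter `i` to receiver `j`, for transmitters at `tx`, receivers at `rx`
and attenuation function `a`.  The diagonal entries are the `SNR_i`, the off-diagonal entries are
the `INR_ij`; the first index is always the transmitter, the second the receiver. -/
def gain {n d : ℕ} (a : ℝ → ℝ) (tx rx : Fin n → EuclideanSpace ℝ (Fin d)) (i j : Fin n) : ℝ :=
  a (dist (tx i) (rx j))

/-- `½ log (1 + 2 x)` for a power gain `x`. -/
def halfLog (x : ℝ) : ℝ := 1 / 2 * Real.log (1 + 2 * x)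

/-- `S_ij = ½ log (1 + 2 INR_ij)` for `i ≠ j`, and `S_ii = ½ log (1 + 2 SNR_i)`. -/
def strength {n d : ℕ} (a : ℝ → ℝ) (tx rx : Fin n → EuclideanSpace ℝ (Fin d)) (i j : Fin n) : ℝ :=
  halfLog (gain a tx rx i j)

/-- `E = ½ 𝔼 log (1 + 2 SNR)`, the expectation over independent positions of a transmitter with
law `PT` and a receiver with law `PR`. -/
def meanStrength {d : ℕ} (a : ℝ → ℝ) (PT PR : Measure (EuclideanSpace ℝ (Fin d))) : ℝ :=
  ∫ p, halfLog (a (dist p.1 p.2)) ∂(PT.prod PR)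

/-- The crosslink `i → j` is an `ε`-bottleneck for the link strengths `S` and the level `E`:
at receiver `i` neither the direct link nor the crosslink from transmitter `j` exceeds
`E + ε / 2`, and transmitter `j` is heard at receiver `i` at least as strongly as at receiver
`j`. -/
structure IsBottleneck {n : ℕ} (S : Fin n → Fin n → ℝ) (E ε : ℝ) (i j : Fin n) : Prop where
  ne : i ≠ j
  direct_le : S i i ≤ E + ε / 2
  cross_le : S j i ≤ E + ε / 2
  direct_le_cross : S j j ≤ S j i

/-- The phases: `θ t i j` is the phase `Θ_ij[t]` from transmitter `i` to receiver `j` at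
time `t`. -/
abbrev Phases (n T : ℕ) : Type := Fin T → Fin n → Fin n → ℝ

/-- The noise: `z j t` is the noise `Z_j[t]` of receiver `j` at time `t`. -/
abbrev Noise (n T : ℕ) : Type := Fin n → Fin T → ℂ

/-- The uniform distribution on `[0, 2π]`. -/
def uniformPhase : Measure ℝ := ProbabilityTheory.cond volume (Set.Icc 0 (2 * Real.pi))

/-- The standard (circularly symmetric, `𝔼 |Z|² = 1`) complex Gaussian distribution. -/
def stdComplexGaussian : Measure ℂ :=
  ((gaussianReal 0 (1 / 2)).prod (gaussianReal 0 (1 / 2))).map (fun p : ℝ × ℝ => ⟨p.1, p.2⟩)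

/-- The joint law of all phases and all noise terms during `T` channel uses: everything is
independent, the phases are uniform on `[0, 2π]` and the noise is standard complex Gaussian. -/
def channelLaw (n T : ℕ) : Measure (Phases n T × Noise n T) :=
  (Measure.pi fun _ => Measure.pi fun _ => Measure.pi fun _ => uniformPhase).prod
    (Measure.pi fun _ => Measure.pi fun _ => stdComplexGaussian)

/-- A code of block length `T` with `M i` messages for user `i`.  Channel state information is
global and causal: the symbol sent at time `t` may depend on the user's own message and on all the
phases up to time `t`, and a receiver knows its own channel output and all the phases. -/
structure Code (n T : ℕ) (M : Fin n → ℕ) where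
  /-- `enc i w θ t` is the symbol `x_i[t]` sent for message `w` when the phases are `θ`. -/
  enc : (i : Fin n) → Fin (M i) → Phases n T → Fin T → ℂ
  measurable_enc : ∀ i w, Measurable (enc i w)
  causal : ∀ i w θ θ' t, (∀ s ≤ t, θ s = θ' s) → enc i w θ t = enc i w θ' t
  power : ∀ i w θ, 1 / (T : ℝ) * ∑ t, ‖enc i w θ t‖ ^ 2 ≤ 1
  /-- `dec j y θ` is the message that receiver `j` decides on when it has received `y`. -/
  dec : (j : Fin n) → (Fin T → ℂ) → Phases n T → Fin (M j)
  measurable_dec : ∀ j, Measurable fun p : (Fin T → ℂ) × Phases n T => dec j p.1 p.2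

/-- The symbol `Y_j[t] = ∑ i, exp (𝐢 Θ_ij[t]) √(g i j) x_i[t] + Z_j[t]` received at receiver `j`
when the message tuple `w` is sent. -/
def received {n T : ℕ} {M : Fin n → ℕ} (g : Fin n → Fin n → ℝ) (c : Code n T M)
    (w : (i : Fin n) → Fin (M i)) (θ : Phases n T) (z : Noise n T) (j : Fin n) (t : Fin T) : ℂ :=
  ∑ i, Complex.exp (Complex.I * (θ t i j : ℂ)) * (Real.sqrt (g i j) : ℂ) * c.enc i (w i) θ t
    + z j t

/-- The probability that receiver `j` decides on a wrong message, when the messages are independent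
and uniformly distributed. -/
def errorProb {n T : ℕ} {M : Fin n → ℕ} (g : Fin n → Fin n → ℝ) (c : Code n T M)
    (j : Fin n) : ℝ :=
  (∑ w : (i : Fin n) → Fin (M i),
    (channelLaw n T).real {p | c.dec j (received g c w p.1 p.2 j) p.1 ≠ w j}) /
      (Fintype.card ((i : Fin n) → Fin (M i)) : ℝ)

/-- The rates `r` (in nats per channel use) are jointly achievable over the network with power
gains `g`: for all long enough block lengths `T` there are codes with at least `exp (T r_i)`
messages for user `i` and arbitrarily small error probabilities at all receivers. -/
def Achievable {n : ℕ} (g : Fin n → Fin n → ℝ) (r : Fin n → ℝ) : Prop :=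
  ∀ δ > (0 : ℝ), ∀ᶠ T : ℕ in atTop, ∃ (M : Fin n → ℕ) (c : Code n T M),
    (∀ i, Real.exp (T * r i) ≤ M i) ∧ ∀ j, errorProb g c j ≤ δ

end GaussianInterference

end

/-! Receiver `i` can decode the messages of both users. Fix all phases and the messages of the other
users. Having decoded its own message, receiver `i` subtracts every known signal and is left with
the signal of transmitter `j` plus noise. Since `g j j ≤ g j i`, multiplying by a factor `k` of
modulus at most one turns this signal into the one that receiver `j` gets from transmitter `j`.
Independent noise restores unit variance, and adding the remaining interference at `j` reproduces
the output law of receiver `j` (`sum_two_user_le`). By the union bound the pair of messages is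
recovered at receiver `i` with error at most the sum of the two errors.

The pair is thus conveyed over one Gaussian channel of received power at most `g i i + g j i`, so `r
i + r j ≤ log (1 + g i i + g j i)`. This is at most `2 * max (S i i) (S j i) ≤ 2 * E + ε`, because
`1 + x + y ≤ 1 + 2 * max x y`.

The channel converse `sum_measureReal_correct_mul_log_le` avoids mutual information. Each output law
is compared with one product Gaussian `Q` of variance `v = 1 + g i i + g j i` by the Gibbs
variational inequality. The decoding regions are disjoint, so their `Q`-masses sum to one. Centring
`Q` at the mean signal cancels the cross terms between the two users. The bound holds pointwise in
the phases and is then integrated. -/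

noncomputable section

namespace GaussianInterference

open scoped NNReal ENNReal

/-! ### Gaussian densities on the line, on `ℂ` and on finite products. -/

/-- The density of a Gaussian with mean `d` and variance `v / 2` with respect to one with mean `0`
and variance `1 / 2`. -/
def realDensity (v d x : ℝ) : ℝ := Real.exp (x ^ 2 - (x - d) ^ 2 / v) / √v

lemma measurable_realDensity (v d : ℝ) : Measurable (realDensity v d) := by
  unfold realDensity
  fun_prop

lemma gaussianReal_withDensity {v : ℝ≥0} (hv : v ≠ 0) (d : ℝ) :
    (gaussianReal 0 (1 / 2)).withDensity (fun x => ENNReal.ofReal (realDensity v d x)) =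
      gaussianReal d (v / 2) := by
  have hv' : (0 : ℝ) < v := by positivity
  rw [gaussianReal_of_var_ne_zero 0 (by norm_num : (1 / 2 : ℝ≥0) ≠ 0),
    gaussianReal_of_var_ne_zero d (by positivity : v / 2 ≠ 0),
    ← withDensity_mul _ (measurable_gaussianPDF _ _)
      (measurable_realDensity _ _).ennreal_ofReal]
  congr 1
  ext x
  rw [Pi.mul_apply, gaussianPDF, gaussianPDF, ← ENNReal.ofReal_mul (gaussianPDFReal_nonneg _ _ _)]
  congr 1
  rw [gaussianPDFReal, gaussianPDFReal, realDensity]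
  push_cast
  have h1 : 2 * Real.pi * ((v : ℝ) / 2) = (2 * Real.pi * (1 / 2)) * v := by ring
  have h2 : -(x - d) ^ 2 / (2 * ((v : ℝ) / 2)) =
      (-(x - 0) ^ 2 / (2 * (1 / 2))) + (x ^ 2 - (x - d) ^ 2 / v) := by
    field_simp
    ring
  rw [h1, h2, Real.exp_add, Real.sqrt_mul (by positivity) (v : ℝ)]
  have h3 : 0 < √(v : ℝ) := Real.sqrt_pos.2 hv'
  have h4 : 0 < √(2 * Real.pi * (1 / 2)) := Real.sqrt_pos.2 (by positivity)
  generalize √(2 * Real.pi * (1 / 2)) = c at *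
  generalize √(v : ℝ) = c' at *
  field_simp

/-- The circularly symmetric complex Gaussian distribution with mean `d` and variance `v`. -/
def complexGaussian (d : ℂ) (v : ℝ≥0) : Measure ℂ :=
  ((gaussianReal d.re (v / 2)).prod (gaussianReal d.im (v / 2))).map (fun p : ℝ × ℝ => ⟨p.1, p.2⟩)

lemma measurable_complexMk : Measurable (fun p : ℝ × ℝ => (⟨p.1, p.2⟩ : ℂ)) :=
  Complex.measurableEquivRealProd.symm.measurable

instance (d : ℂ) (v : ℝ≥0) : IsProbabilityMeasure (complexGaussian d v) :=
  Measure.isProbabilityMeasure_map measurable_complexMk.aemeasurable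

instance : IsProbabilityMeasure stdComplexGaussian :=
  Measure.isProbabilityMeasure_map measurable_complexMk.aemeasurable

lemma map_add_const_complexGaussian (d m : ℂ) (v : ℝ≥0) :
    (complexGaussian d v).map (fun z => m + z) = complexGaussian (m + d) v := by
  unfold complexGaussian
  rw [Measure.map_map (by fun_prop) measurable_complexMk, Complex.add_re, Complex.add_im,
    add_comm m.re, add_comm m.im,
    ← gaussianReal_map_const_add m.re, ← gaussianReal_map_const_add m.im,
    Measure.map_prod_map _ _ (by fun_prop) (by fun_prop),
    Measure.map_map measurable_complexMk (by fun_prop)]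
  congr 1

/-- The density of `complexGaussian d v` with respect to the standard complex Gaussian. -/
def complexDensity (v : ℝ) (d z : ℂ) : ℝ := Real.exp (‖z‖ ^ 2 - ‖z - d‖ ^ 2 / v) / v

lemma complexDensity_nonneg {v : ℝ} (hv : 0 ≤ v) (d z : ℂ) : 0 ≤ complexDensity v d z := by
  unfold complexDensity
  positivity

lemma measurable_complexDensity (v : ℝ) (d : ℂ) : Measurable (complexDensity v d) := by
  unfold complexDensity
  fun_prop

lemma complexDensity_mk {v : ℝ} (hv : 0 ≤ v) (d : ℂ) (x y : ℝ) :
    complexDensity v d ⟨x, y⟩ = realDensity v d.re x * realDensity v d.im y := by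
  unfold complexDensity realDensity
  rw [div_mul_div_comm, Real.mul_self_sqrt hv, ← Real.exp_add, Complex.sq_norm, Complex.sq_norm,
    Complex.normSq_apply, Complex.normSq_apply]
  simp only [Complex.sub_re, Complex.sub_im]
  congr 2
  ring

lemma map_withDensity_comp {α β : Type*} [MeasurableSpace α] [MeasurableSpace β] (μ : Measure α)
    {e : α → β} (he : Measurable e) {f : β → ℝ≥0∞} (hf : Measurable f) :
    (μ.map e).withDensity f = (μ.withDensity (f ∘ e)).map e := by
  ext s hs
  rw [withDensity_apply _ hs, Measure.map_apply he hs, withDensity_apply _ (he hs),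
    setLIntegral_map hs hf he]
  rfl

lemma stdComplexGaussian_withDensity {v : ℝ≥0} (hv : v ≠ 0) (d : ℂ) :
    stdComplexGaussian.withDensity (fun z => ENNReal.ofReal (complexDensity v d z)) =
      complexGaussian d v := by
  unfold stdComplexGaussian complexGaussian
  rw [map_withDensity_comp _ measurable_complexMk (measurable_complexDensity _ _).ennreal_ofReal,
    ← gaussianReal_withDensity hv, ← gaussianReal_withDensity hv,
    prod_withDensity (measurable_realDensity _ _).ennreal_ofReal
      (measurable_realDensity _ _).ennreal_ofReal]
  congr 2
  ext p
  rw [Function.comp_apply, complexDensity_mk v.coe_nonneg, ENNReal.ofReal_mul]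
  unfold realDensity
  positivity

/-- A product measure is determined by its values on boxes, where the integral of a product of
one-variable functions factors. Finiteness of the reweighted factors supplies the integrability that
this needs. -/
lemma pi_withDensity {ι : Type*} [Fintype ι] {X : ι → Type*} [∀ i, MeasurableSpace (X i)]
    (μ : ∀ i, Measure (X i)) [∀ i, IsFiniteMeasure (μ i)] {f : ∀ i, X i → ℝ}
    (hf : ∀ i, Measurable (f i)) (hf0 : ∀ i x, 0 ≤ f i x)
    [∀ i, IsFiniteMeasure ((μ i).withDensity fun x => ENNReal.ofReal (f i x))] :
    (Measure.pi μ).withDensity (fun x => ENNReal.ofReal (∏ i, f i (x i))) =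
      Measure.pi fun i => (μ i).withDensity fun x => ENNReal.ofReal (f i x) := by
  have hint : ∀ i, Integrable (f i) (μ i) := fun i => by
    refine ⟨(hf i).aestronglyMeasurable, ?_⟩
    rw [hasFiniteIntegral_iff_ofReal (ae_of_all _ (hf0 i))]
    have := measure_lt_top ((μ i).withDensity fun x => ENNReal.ofReal (f i x)) Set.univ
    rwa [withDensity_apply _ MeasurableSet.univ, Measure.restrict_univ] at this
  refine (Measure.pi_eq fun s hs => ?_).symm
  rw [withDensity_apply _ (MeasurableSet.univ_pi hs), Measure.restrict_pi_pi,
    ← ofReal_integral_eq_lintegral_ofReal, integral_fintype_prod_eq_prod,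
    ENNReal.ofReal_prod_of_nonneg]
  · refine Finset.prod_congr rfl fun i _ => ?_
    rw [withDensity_apply _ (hs i), ← ofReal_integral_eq_lintegral_ofReal
      (hint i).restrict (ae_of_all _ (hf0 i))]
  · exact fun i _ => integral_nonneg (hf0 i)
  · exact Integrable.fintype_prod_dep fun i => (hint i).restrict
  · exact ae_of_all _ fun x => Finset.prod_nonneg fun i _ => hf0 i _

/-! ### Translations, moments and combinations of Gaussian noise. -/

section Noise

variable {τ : Type*} [Fintype τ]

/-- The law of independent standard complex Gaussian noise terms. -/
abbrev noiseLaw (τ : Type*) [Fintype τ] : Measure (τ → ℂ) :=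
  Measure.pi fun _ => stdComplexGaussian

/-- After translation by `m`, the noise law reweighted by the Gaussian density with mean `μ - m`
no longer depends on `m`. -/
lemma map_withDensity_noiseLaw {v : ℝ≥0} (hv : v ≠ 0) (m μ : τ → ℂ) :
    ((noiseLaw τ).withDensity fun z => ENNReal.ofReal (∏ t, complexDensity v (μ t - m t) (z t))).map
      (fun z => m + z) = Measure.pi fun t => complexGaussian (μ t) v := by
  have : ∀ t, IsFiniteMeasure (stdComplexGaussian.withDensity
      fun z => ENNReal.ofReal (complexDensity v (μ t - m t) z)) := fun t => by
    rw [stdComplexGaussian_withDensity hv]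
    infer_instance
  rw [pi_withDensity _ (fun t => measurable_complexDensity v _)
    (fun t => complexDensity_nonneg v.coe_nonneg _)]
  simp_rw [stdComplexGaussian_withDensity hv]
  have h := Measure.pi_map_pi (μ := fun t => complexGaussian (μ t - m t) v)
    (f := fun t z => m t + z) (hμ := fun t => by
      rw [map_add_const_complexGaussian]; infer_instance) (fun t => by fun_prop)
  simp_rw [map_add_const_complexGaussian, add_sub_cancel] at h
  exact h

lemma integrable_sq_gaussianReal (μ : ℝ) (v : ℝ≥0) :
    Integrable (fun x => x ^ 2) (gaussianReal μ v) := by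
  simpa using (memLp_id_gaussianReal (μ := μ) (v := v) 2).integrable_sq

lemma integrable_id_gaussianReal (μ : ℝ) (v : ℝ≥0) :
    Integrable (fun x => x) (gaussianReal μ v) :=
  (memLp_id_gaussianReal (μ := μ) (v := v) 1).integrable (by simp)

lemma integral_sq_gaussianReal_zero (v : ℝ≥0) : ∫ x, x ^ 2 ∂gaussianReal 0 v = v := by
  have h := variance_id_gaussianReal (μ := 0) (v := v)
  rw [variance_of_integral_eq_zero aemeasurable_id (by simp)] at h
  simpa using h

lemma sq_norm_mk_add (p : ℝ × ℝ) (d : ℂ) : ‖(⟨p.1, p.2⟩ : ℂ) + d‖ ^ 2 =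
    (p.1 ^ 2 + 2 * d.re * p.1) + (p.2 ^ 2 + 2 * d.im * p.2) + ‖d‖ ^ 2 := by
  rw [Complex.sq_norm, Complex.sq_norm, Complex.normSq_apply, Complex.normSq_apply]
  simp only [Complex.add_re, Complex.add_im]
  ring

lemma integrable_norm_add_sq (d : ℂ) :
    Integrable (fun z => ‖z + d‖ ^ 2) stdComplexGaussian := by
  unfold stdComplexGaussian
  rw [integrable_map_measure (by fun_prop) measurable_complexMk.aemeasurable]
  simp only [Function.comp_def, sq_norm_mk_add]
  have h : ∀ c : ℝ, Integrable (fun x => x ^ 2 + 2 * c * x) (gaussianReal 0 (1 / 2)) := fun c =>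
    (integrable_sq_gaussianReal _ _).add ((integrable_id_gaussianReal _ _).const_mul _)
  exact (((h d.re).comp_fst _).add ((h d.im).comp_snd _)).add (integrable_const _)

lemma integral_norm_add_sq (d : ℂ) :
    ∫ z, ‖z + d‖ ^ 2 ∂stdComplexGaussian = 1 + ‖d‖ ^ 2 := by
  unfold stdComplexGaussian
  rw [integral_map measurable_complexMk.aemeasurable (by fun_prop)]
  simp only [sq_norm_mk_add]
  have h : ∀ c : ℝ, Integrable (fun x => x ^ 2 + 2 * c * x) (gaussianReal 0 (1 / 2)) := fun c =>
    (integrable_sq_gaussianReal _ _).add ((integrable_id_gaussianReal _ _).const_mul _)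
  have h' : ∀ c : ℝ, ∫ x, (x ^ 2 + 2 * c * x) ∂gaussianReal 0 (1 / 2) = 1 / 2 := fun c => by
    rw [integral_add (integrable_sq_gaussianReal _ _)
      ((integrable_id_gaussianReal _ _).const_mul _), integral_const_mul,
      integral_sq_gaussianReal_zero, integral_id_gaussianReal]
    simp
  have h1 := (h d.re).comp_fst (gaussianReal 0 (1 / 2))
  have h2 := (h d.im).comp_snd (gaussianReal 0 (1 / 2))
  have h12 : Integrable (fun p : ℝ × ℝ => p.1 ^ 2 + 2 * d.re * p.1 + (p.2 ^ 2 + 2 * d.im * p.2))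
      ((gaussianReal 0 (1 / 2)).prod (gaussianReal 0 (1 / 2))) := h1.add h2
  rw [integral_add h12 (integrable_const _), integral_add h1 h2,
    integral_fun_fst (fun x => x ^ 2 + 2 * d.re * x),
    integral_fun_snd (fun x => x ^ 2 + 2 * d.im * x), h', h']
  simp
  norm_num

/-- Dependence on `‖t‖` alone, through the exponential of a square, is what makes the law stable
under combinations with complex coefficients. -/
lemma charFun_stdComplexGaussian (t : ℂ) :
    charFun stdComplexGaussian t = Complex.exp (-(‖t‖ ^ 2 / 4 : ℝ)) := by
  unfold stdComplexGaussian
  rw [charFun_apply, integral_map measurable_complexMk.aemeasurable (by fun_prop)]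
  have h : ∀ p : ℝ × ℝ, Complex.exp ((inner ℝ (⟨p.1, p.2⟩ : ℂ) t : ℝ) * Complex.I) =
      Complex.exp ((inner ℝ p.1 t.re : ℝ) * Complex.I) *
        Complex.exp ((inner ℝ p.2 t.im : ℝ) * Complex.I) := fun p => by
    rw [← Complex.exp_add, ← add_mul, ← Complex.ofReal_add]
    congr 3
    simp [Complex.inner]
  simp_rw [h]
  rw [integral_prod_mul (fun x => Complex.exp ((inner ℝ x t.re : ℝ) * Complex.I))
    (fun x => Complex.exp ((inner ℝ x t.im : ℝ) * Complex.I)), ← charFun_apply, ← charFun_apply,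
    charFun_gaussianReal, charFun_gaussianReal, ← Complex.exp_add]
  congr 1
  rw [Complex.sq_norm, Complex.normSq_apply]
  push_cast
  ring

/-- A combination of independent standard complex Gaussians whose coefficients have squared moduli
that sum to one is a standard complex Gaussian. -/
lemma map_combination_stdComplexGaussian (k s : ℂ) (hks : ‖k‖ ^ 2 + ‖s‖ ^ 2 = 1) :
    (stdComplexGaussian.prod stdComplexGaussian).map (fun p => k * p.1 + s * p.2) =
      stdComplexGaussian := by
  have : IsProbabilityMeasure ((stdComplexGaussian.prod stdComplexGaussian).map
    (fun p => k * p.1 + s * p.2)) := Measure.isProbabilityMeasure_map (by fun_prop)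
  apply Measure.ext_of_charFun
  ext t
  rw [charFun_apply, integral_map (by fun_prop) (by fun_prop)]
  have h : ∀ p : ℂ × ℂ, Complex.exp ((inner ℝ (k * p.1 + s * p.2) t : ℝ) * Complex.I) =
      Complex.exp ((inner ℝ p.1 ((starRingEnd ℂ) k * t) : ℝ) * Complex.I) *
        Complex.exp ((inner ℝ p.2 ((starRingEnd ℂ) s * t) : ℝ) * Complex.I) := fun p => by
    rw [← Complex.exp_add, ← add_mul, ← Complex.ofReal_add]
    congr 3
    simp [Complex.inner]
    ring
  simp_rw [h]
  rw [integral_prod_mul (fun x => Complex.exp ((inner ℝ x ((starRingEnd ℂ) k * t) : ℝ) * Complex.I))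
    (fun x => Complex.exp ((inner ℝ x ((starRingEnd ℂ) s * t) : ℝ) * Complex.I)), ← charFun_apply,
    ← charFun_apply, charFun_stdComplexGaussian, charFun_stdComplexGaussian,
    charFun_stdComplexGaussian, ← Complex.exp_add, norm_mul, norm_mul, RCLike.norm_conj,
    RCLike.norm_conj, ← Complex.ofReal_neg, ← Complex.ofReal_neg, ← Complex.ofReal_neg,
    ← Complex.ofReal_add]
  congr 2
  linear_combination (-‖t‖ ^ 2 / 4) * hks

lemma measurePreserving_combination_noiseLaw (k s : τ → ℂ)
    (hks : ∀ t, ‖k t‖ ^ 2 + ‖s t‖ ^ 2 = 1) :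
    MeasurePreserving (fun p : (τ → ℂ) × (τ → ℂ) => k * p.1 + s * p.2)
      ((noiseLaw τ).prod (noiseLaw τ)) (noiseLaw τ) := by
  have h1 := (measurePreserving_arrowProdEquivProdArrow ℂ ℂ τ (fun _ => stdComplexGaussian)
    (fun _ => stdComplexGaussian)).symm
  have h2 := measurePreserving_pi (fun _ : τ => stdComplexGaussian.prod stdComplexGaussian)
    (fun _ => stdComplexGaussian) (f := fun t p => k t * p.1 + s t * p.2)
    (fun t => ⟨by fun_prop, map_combination_stdComplexGaussian _ _ (hks t)⟩)
  exact h2.comp h1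

end Noise

/-! ### Converse of the channel coding theorem by change of measure. -/

section Converse

variable {τ : Type*} [Fintype τ]

/-- The density of independent complex Gaussians with means `d t` and variance `v` with respect to
the noise law. -/
def noiseDensity (v : ℝ) (d z : τ → ℂ) : ℝ := ∏ t, complexDensity v (d t) (z t)

/-- The log-likelihood ratio `-log (noiseDensity v d z)`. -/
def logRatio (v : ℝ) (d z : τ → ℂ) : ℝ :=
  ∑ t, (Real.log v - ‖z t‖ ^ 2 + ‖z t - d t‖ ^ 2 / v)

lemma noiseDensity_eq_exp {v : ℝ} (hv : 0 < v) (d z : τ → ℂ) :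
    noiseDensity v d z = Real.exp (-logRatio v d z) := by
  unfold noiseDensity logRatio complexDensity
  rw [← Finset.sum_neg_distrib, Real.exp_sum]
  refine Finset.prod_congr rfl fun t _ => ?_
  nth_rw 2 [← Real.exp_log hv]
  rw [← Real.exp_sub]
  congr 1
  ring

lemma measurable_noiseDensity (v : ℝ) (d : τ → ℂ) : Measurable (noiseDensity v d) := by
  unfold noiseDensity complexDensity
  fun_prop

lemma noiseDensity_nonneg {v : ℝ} (hv : 0 ≤ v) (d z : τ → ℂ) : 0 ≤ noiseDensity v d z :=
  Finset.prod_nonneg fun _ _ => complexDensity_nonneg hv _ _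

lemma withDensity_noiseDensity {v : ℝ≥0} (hv : v ≠ 0) (d : τ → ℂ) :
    (noiseLaw τ).withDensity (fun z => ENNReal.ofReal (noiseDensity v d z)) =
      Measure.pi fun t => complexGaussian (d t) v := by
  have h := map_withDensity_noiseLaw hv 0 d
  simpa [noiseDensity, Measure.map_id'] using h

lemma lintegral_noiseDensity {v : ℝ≥0} (hv : v ≠ 0) (d : τ → ℂ) (C : Set (τ → ℂ))
    (hC : MeasurableSet C) :
    ∫⁻ z in C, ENNReal.ofReal (noiseDensity v d z) ∂noiseLaw τ =
      (Measure.pi fun t => complexGaussian (d t) v) C := by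
  rw [← withDensity_noiseDensity hv, withDensity_apply _ hC]

lemma integrable_noiseDensity {v : ℝ≥0} (hv : v ≠ 0) (d : τ → ℂ) :
    Integrable (noiseDensity v d) (noiseLaw τ) := by
  refine ⟨(measurable_noiseDensity _ _).aestronglyMeasurable, ?_⟩
  rw [hasFiniteIntegral_iff_ofReal (ae_of_all _ (noiseDensity_nonneg v.coe_nonneg d)),
    ← setLIntegral_univ, lintegral_noiseDensity hv d _ MeasurableSet.univ]
  exact measure_lt_top _ _

lemma setIntegral_noiseDensity {v : ℝ≥0} (hv : v ≠ 0) (d : τ → ℂ) {C : Set (τ → ℂ)}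
    (hC : MeasurableSet C) :
    ∫ z in C, noiseDensity v d z ∂noiseLaw τ =
      (Measure.pi fun t => complexGaussian (d t) v).real C := by
  rw [integral_eq_lintegral_of_nonneg_ae (ae_of_all _ (noiseDensity_nonneg v.coe_nonneg d))
    (measurable_noiseDensity _ _).aestronglyMeasurable, lintegral_noiseDensity hv d _ hC]
  rfl

lemma integrable_norm_sub_sq (d : ℂ) :
    Integrable (fun z => ‖z - d‖ ^ 2) stdComplexGaussian := by
  simpa [sub_eq_add_neg] using integrable_norm_add_sq (-d)

lemma integral_norm_sub_sq (d : ℂ) :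
    ∫ z, ‖z - d‖ ^ 2 ∂stdComplexGaussian = 1 + ‖d‖ ^ 2 := by
  simpa [sub_eq_add_neg] using integral_norm_add_sq (-d)

lemma integrable_logRatio_term (v : ℝ) (d : ℂ) :
    Integrable (fun z => Real.log v - ‖z‖ ^ 2 + ‖z - d‖ ^ 2 / v) stdComplexGaussian := by
  have h := integrable_norm_sub_sq 0
  simp only [sub_zero] at h
  exact ((integrable_const _).sub h).add ((integrable_norm_sub_sq d).div_const v)

lemma integrable_logRatio (v : ℝ) (d : τ → ℂ) : Integrable (logRatio v d) (noiseLaw τ) :=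
  integrable_finsetSum _ fun t _ =>
    integrable_comp_eval (μ := fun _ : τ => stdComplexGaussian) (integrable_logRatio_term v (d t))

/-- This is the relative entropy of the noise law with respect to the Gaussian with means `d t` and
variance `v`. -/
lemma integral_logRatio (v : ℝ) (d : τ → ℂ) :
    ∫ z, logRatio v d z ∂noiseLaw τ =
      Fintype.card τ * (Real.log v - 1) + (Fintype.card τ + ∑ t, ‖d t‖ ^ 2) / v := by
  unfold logRatio
  have h0 := integrable_norm_sub_sq 0
  have h0' := integral_norm_sub_sq 0
  simp only [sub_zero] at h0 h0'
  have h1 : Integrable (fun z => Real.log v - ‖z‖ ^ 2) stdComplexGaussian :=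
    (integrable_const _).sub h0
  rw [integral_finsetSum _ fun t _ => integrable_comp_eval
    (μ := fun _ : τ => stdComplexGaussian) (integrable_logRatio_term v (d t))]
  have h : ∀ t, ∫ z : τ → ℂ, (Real.log v - ‖z t‖ ^ 2 + ‖z t - d t‖ ^ 2 / v) ∂noiseLaw τ =
      (Real.log v - 1) + (1 + ‖d t‖ ^ 2) / v := fun t => by
    rw [integral_comp_eval (μ := fun _ : τ => stdComplexGaussian)
      (f := fun z => Real.log v - ‖z‖ ^ 2 + ‖z - d t‖ ^ 2 / v)
      (integrable_logRatio_term v (d t)).aestronglyMeasurable,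
      integral_add h1 ((integrable_norm_sub_sq _).div_const v),
      integral_sub (integrable_const _) h0, h0', integral_div, integral_norm_sub_sq]
    simp
  simp_rw [h]
  rw [Finset.sum_add_distrib, ← Finset.sum_div, Finset.sum_add_distrib]
  simp [mul_sub]

/-- The Gibbs variational inequality for the function `log M` on `C` and `0` elsewhere. -/
lemma measureReal_mul_log_le {v : ℝ≥0} (hv : v ≠ 0) (d : τ → ℂ) {C : Set (τ → ℂ)}
    (hC : MeasurableSet C) {M : ℝ} (hM : 1 ≤ M) :
    (noiseLaw τ).real C * Real.log M ≤
      (Fintype.card τ * (Real.log v - 1) + (Fintype.card τ + ∑ t, ‖d t‖ ^ 2) / v) +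
        ((1 + (M - 1) * (Measure.pi fun t => complexGaussian (d t) v).real C) / 2 - 1 +
          Real.log 2) := by
  have hv' : (0 : ℝ) < v := by positivity
  have hpt : ∀ z, C.indicator (fun _ => Real.log M) z ≤ logRatio v d z +
      ((noiseDensity v d z + (M - 1) * C.indicator (noiseDensity v d) z) / 2 - 1 + Real.log 2) := by
    intro z
    have key : ∀ x : ℝ, 0 < x →
        Real.log x - logRatio v d z ≤ x * noiseDensity v d z / 2 - 1 + Real.log 2 := fun x hx => by
      have hg : 0 < noiseDensity v d z := by
        rw [noiseDensity_eq_exp hv']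
        exact Real.exp_pos _
      -- The logarithm is bounded by its tangent at `2`, which keeps the estimate linear in the mass
      -- of `C` so that it can be summed over messages. The point `2` fits because `1 + (M - 1) *
      -- Q(C)` averages to less than `2` when `M` disjoint sets share total mass one.
      have h := Real.log_le_sub_one_of_pos (show 0 < x * noiseDensity v d z / 2 by positivity)
      rw [Real.log_div (by positivity) (by norm_num), Real.log_mul hx.ne' hg.ne',
        noiseDensity_eq_exp hv', Real.log_exp] at h
      rw [noiseDensity_eq_exp hv']
      linarith
    by_cases hz : z ∈ C
    · have := key M (by linarith)
      simp only [Set.indicator_of_mem hz]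
      linarith
    · have := key 1 one_pos
      rw [Real.log_one] at this
      simp only [Set.indicator_of_notMem hz]
      linarith
  have hi1 : Integrable (C.indicator fun _ => Real.log M) (noiseLaw τ) :=
    (integrable_const _).indicator hC
  have hg := integrable_noiseDensity hv d
  have hgC : Integrable (fun z => (M - 1) * C.indicator (noiseDensity v d) z) (noiseLaw τ) :=
    (hg.indicator hC).const_mul _
  have hi2 : Integrable (fun z => (noiseDensity v d z +
      (M - 1) * C.indicator (noiseDensity v d) z) / 2) (noiseLaw τ) := (hg.add hgC).div_const 2
  have hi3 : Integrable (fun z => (noiseDensity v d z +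
      (M - 1) * C.indicator (noiseDensity v d) z) / 2 - 1) (noiseLaw τ) :=
    hi2.sub (integrable_const _)
  have hi4 : Integrable (fun z => (noiseDensity v d z +
      (M - 1) * C.indicator (noiseDensity v d) z) / 2 - 1 + Real.log 2) (noiseLaw τ) :=
    hi3.add (integrable_const _)
  have h := integral_mono hi1 ((integrable_logRatio v d).add hi4) hpt
  have htot := setIntegral_noiseDensity hv d MeasurableSet.univ
  rw [setIntegral_univ, probReal_univ] at htot
  rw [integral_indicator_const _ hC, integral_add' (integrable_logRatio v d) hi4,
    integral_add hi3 (integrable_const _), integral_sub hi2 (integrable_const _), integral_div,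
    integral_add hg hgC, integral_const_mul, integral_indicator hC,
    setIntegral_noiseDensity hv d hC, integral_logRatio, htot] at h
  simpa using h

/-- The converse of the channel coding theorem for a Gaussian channel: `m w` is the signal that
conveys `w`, and `φ` is the decoder. -/
theorem sum_measureReal_correct_mul_log_le {W : Type*} [Fintype W] [Nonempty W] {v : ℝ≥0}
    (hv : v ≠ 0) (m : W → τ → ℂ) (μ : τ → ℂ) (φ : (τ → ℂ) → W)
    (hφ : ∀ w, MeasurableSet (φ ⁻¹' {w})) {V : ℝ}
    (hm : ∑ w, ∑ t, ‖μ t - m w t‖ ^ 2 ≤ Fintype.card W * V)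
    (hV : Fintype.card τ + V ≤ v * Fintype.card τ) :
    (∑ w, (noiseLaw τ).real {z | φ (m w + z) = w}) * Real.log (Fintype.card W) ≤
      Fintype.card W * (Fintype.card τ * Real.log v + Real.log 2) := by
  have hv' : (0 : ℝ) < v := by positivity
  have hM : (1 : ℝ) ≤ Fintype.card W := by exact_mod_cast Fintype.card_pos
  set Q : Measure (τ → ℂ) := Measure.pi fun t => complexGaussian (μ t) v with hQ
  have hmeas : ∀ w, MeasurableSet {z | φ (m w + z) = w} := fun w =>
    (measurable_const_add (m w)) (hφ w)
  -- Translating by `m w` carries the reference Gaussian centred at `μ - m w` to `Q`, which is the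
  -- same for all messages. Each event becomes a decoding region, and these regions partition the
  -- space.
  have hQw : ∀ w, (Measure.pi fun t => complexGaussian ((μ - m w) t) v).real
      {z | φ (m w + z) = w} = Q.real (φ ⁻¹' {w}) := fun w => by
    rw [hQ, ← map_withDensity_noiseLaw hv (m w) μ, map_measureReal_apply (by fun_prop) (hφ w),
      ← withDensity_noiseDensity hv]
    rfl
  have hsum : ∑ w, Q.real (φ ⁻¹' {w}) = 1 := by
    rw [sum_measureReal_preimage_singleton _ fun w _ => hφ w]
    simp
  have h : ∀ w ∈ Finset.univ, (noiseLaw τ).real {z | φ (m w + z) = w} *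
      Real.log (Fintype.card W) ≤
      (Fintype.card τ * (Real.log v - 1) + (Fintype.card τ + ∑ t, ‖μ t - m w t‖ ^ 2) / v) +
        ((1 + (Fintype.card W - 1) * Q.real (φ ⁻¹' {w})) / 2 - 1 + Real.log 2) := fun w _ => by
    have := measureReal_mul_log_le hv (μ - m w) (hmeas w) hM
    rw [hQw] at this
    exact this
  have hs := Finset.sum_le_sum h
  rw [← Finset.sum_mul] at hs
  refine hs.trans ?_
  simp only [Finset.sum_add_distrib, Finset.sum_sub_distrib, ← Finset.sum_div, ← Finset.mul_sum,
    hsum, Finset.sum_const, Finset.card_univ, nsmul_eq_mul]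
  -- By the power constraint, the quadratic part of the relative entropy is absorbed by the `-1` in
  -- `log v - 1`.
  have h2 : (Fintype.card W * Fintype.card τ + ∑ w, ∑ t, ‖μ t - m w t‖ ^ 2) / (v : ℝ) ≤
      Fintype.card W * Fintype.card τ := by
    rw [div_le_iff₀ hv']
    nlinarith
  linarith

end Converse

/-! ### Second moments of sums of centred families. -/

section Average

variable {α β : Type*} [Fintype α] [Fintype β] {E : Type*} [NormedAddCommGroup E]
  [InnerProductSpace ℝ E]

/-- The average of a finite family. -/
def average (f : α → E) : E := (Fintype.card α : ℝ)⁻¹ • ∑ a, f a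

/-- The cross terms factor as the inner product of the two total sums, so centring one family
suffices. -/
lemma sum_norm_add_sq_of_sum_eq_zero {f : α → E} {g : β → E} (hf : ∑ a, f a = 0) :
    ∑ p : α × β, ‖f p.1 + g p.2‖ ^ 2 =
      Fintype.card β * ∑ a, ‖f a‖ ^ 2 + Fintype.card α * ∑ b, ‖g b‖ ^ 2 := by
  have h : ∑ a, ∑ b, inner ℝ (f a) (g b) = (0 : ℝ) := by
    simp_rw [← inner_sum]
    rw [← sum_inner, hf, inner_zero_left]
  rw [Fintype.sum_prod_type]
  simp_rw [norm_add_sq_real, Finset.sum_add_distrib, ← Finset.mul_sum]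
  rw [h]
  simp [Finset.mul_sum]

variable [Nonempty α] [Nonempty β]

lemma card_smul_average (f : α → E) : (Fintype.card α : ℝ) • average f = ∑ a, f a := by
  rw [average, smul_inv_smul₀]
  exact_mod_cast Fintype.card_ne_zero

lemma sum_average_sub (f : α → E) : ∑ a, (average f - f a) = 0 := by
  rw [Finset.sum_sub_distrib, Finset.sum_const, Finset.card_univ, ← Nat.cast_smul_eq_nsmul ℝ,
    card_smul_average, sub_self]

lemma sum_norm_average_sub_sq_le (f : α → E) :
    ∑ a, ‖average f - f a‖ ^ 2 ≤ ∑ a, ‖f a‖ ^ 2 := by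
  simp_rw [norm_sub_sq_real]
  rw [Finset.sum_add_distrib, Finset.sum_sub_distrib, ← Finset.mul_sum, ← inner_sum,
    ← card_smul_average f, real_inner_smul_right, real_inner_self_eq_norm_sq, Finset.sum_const,
    Finset.card_univ, nsmul_eq_mul]
  have : 0 ≤ (Fintype.card α : ℝ) * ‖average f‖ ^ 2 := by positivity
  linarith

/-- Powers of the two users add even when their signals have nonzero means: centring removes the
cross terms and does not increase the power. -/
lemma sum_norm_averages_sub_sq_le (f : α → E) (g : β → E) :
    ∑ p : α × β, ‖(average f - f p.1) + (average g - g p.2)‖ ^ 2 ≤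
      Fintype.card β * ∑ a, ‖f a‖ ^ 2 + Fintype.card α * ∑ b, ‖g b‖ ^ 2 := by
  rw [sum_norm_add_sq_of_sum_eq_zero (f := fun a => average f - f a)
    (g := fun b => average g - g b) (sum_average_sub f)]
  exact add_le_add (mul_le_mul_of_nonneg_left (sum_norm_average_sub_sq_le f) (by positivity))
    (mul_le_mul_of_nonneg_left (sum_norm_average_sub_sq_le g) (by positivity))

end Average

/-! ### Simulation of the second receiver by the first. -/

section TwoUser

variable {τ : Type*} [Fintype τ] {α β : Type*} [Fintype α] [Fintype β] [Nonempty α] [Nonempty β]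

/-- The error probability of a decoder `φ` for `w` when the signal `m` is sent. -/
def signalError {W : Type*} (φ : (τ → ℂ) → W) (m : τ → ℂ) (w : W) : ℝ :=
  (noiseLaw τ).real {z | φ (m + z) ≠ w}

/-- Two users with a degraded crosslink, for fixed phases.  The first receiver sees the signals
`A a + B b + C` and decodes `a`; the second one sees `k * B b + A' a`, with `‖k t‖ ≤ 1`, and
decodes `b`.  Having decoded `a`, the first receiver can simulate the second one. -/
theorem sum_two_user_le {v : ℝ≥0} (hv : v ≠ 0) (A A' : α → τ → ℂ) (B : β → τ → ℂ) (C k : τ → ℂ)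
    (hk : ∀ t, ‖k t‖ ≤ 1) {p q : ℝ} (hA : ∀ a, ∑ t, ‖A a t‖ ^ 2 ≤ p)
    (hB : ∀ b, ∑ t, ‖B b t‖ ^ 2 ≤ q) (hV : Fintype.card τ + (p + q) ≤ v * Fintype.card τ)
    (φ : (τ → ℂ) → α) (hφ : ∀ a, MeasurableSet (φ ⁻¹' {a}))
    (ψ : (τ → ℂ) → β) (hψ : ∀ b, MeasurableSet (ψ ⁻¹' {b})) :
    (∑ w : α × β, (1 - signalError φ (A w.1 + B w.2 + C) w.1 -
        signalError ψ (k * B w.2 + A' w.1) w.2)) * Real.log (Fintype.card α * Fintype.card β) ≤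
      Fintype.card α * Fintype.card β * (Fintype.card τ * Real.log v + Real.log 2) := by
  have hcα : (1 : ℝ) ≤ Fintype.card α := by exact_mod_cast Fintype.card_pos
  have hcβ : (1 : ℝ) ≤ Fintype.card β := by exact_mod_cast Fintype.card_pos
  -- The weight of the artificial noise that brings noise attenuated by `k` back to unit variance.
  set s : τ → ℂ := fun t => (√(1 - ‖k t‖ ^ 2) : ℂ) with hs
  have hks : ∀ t, ‖k t‖ ^ 2 + ‖s t‖ ^ 2 = 1 := fun t => by
    have : 0 ≤ 1 - ‖k t‖ ^ 2 := by nlinarith [hk t, norm_nonneg (k t)]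
    rw [hs]
    simp only [Complex.norm_real, Real.norm_eq_abs, sq_abs, Real.sq_sqrt this]
    ring
  set m : α × β → τ → ℂ := fun w => A w.1 + B w.2 + C with hm
  -- When `φ y` is correct, the argument of `ψ` is distributed like the output of the second
  -- receiver, with noise `k * z + s * z'`.
  set sim : (τ → ℂ) → (τ → ℂ) → α × β := fun z' y =>
    (φ y, ψ (k * (y - A (φ y) - C) + s * z' + A' (φ y))) with hsim
  have hjoint : ∀ w : α × β, MeasurableSet
      {x : (τ → ℂ) × (τ → ℂ) | sim x.2 x.1 = w} := fun w => by
    have : {x : (τ → ℂ) × (τ → ℂ) | sim x.2 x.1 = w} =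
        (Prod.fst ⁻¹' (φ ⁻¹' {w.1})) ∩
          ((fun x : (τ → ℂ) × (τ → ℂ) => k * (x.1 - A w.1 - C) + s * x.2 + A' w.1) ⁻¹'
            (ψ ⁻¹' {w.2})) := by
      ext x
      simp only [hsim, Set.mem_ofPred_eq, Set.mem_inter_iff, Set.mem_preimage,
        Set.mem_singleton_iff, Prod.ext_iff]
      constructor
      · rintro ⟨h1, h2⟩
        exact ⟨h1, h1 ▸ h2⟩
      · rintro ⟨h1, h2⟩
        exact ⟨h1, by rw [h1]; exact h2⟩
    rw [this]
    have hmeas : Measurable fun x : (τ → ℂ) × (τ → ℂ) =>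
        k * (x.1 - A w.1 - C) + s * x.2 + A' w.1 := by fun_prop
    exact (measurable_fst (hφ _)).inter (hmeas (hψ _))
  have hsub : ∀ w, MeasurableSet {x : (τ → ℂ) × (τ → ℂ) | sim x.2 (m w + x.1) = w} := fun w =>
    (show Measurable fun x : (τ → ℂ) × (τ → ℂ) => (m w + x.1, x.2) by fun_prop) (hjoint w)
  -- Freezing the artificial noise `z'` leaves a deterministic decoder, to which the converse
  -- applies; `z'` is averaged out at the end.
  have hconv : ∀ z', (∑ w, (noiseLaw τ).real {z | sim z' (m w + z) = w}) *
      Real.log (Fintype.card α * Fintype.card β) ≤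
      Fintype.card α * Fintype.card β * (Fintype.card τ * Real.log v + Real.log 2) := fun z' => by
    have h := sum_measureReal_correct_mul_log_le hv m
      (fun t => average (fun a => A a t) + average (fun b => B b t) + C t) (sim z')
      (fun w => (show Measurable fun y : τ → ℂ => (y, z') by fun_prop) (hjoint w))
      (V := p + q) ?_ hV
    · simpa using h
    · rw [Finset.sum_comm]
      calc ∑ t, ∑ w, ‖average (fun a => A a t) + average (fun b => B b t) + C t - m w t‖ ^ 2
          ≤ ∑ t, (Fintype.card β * ∑ a, ‖A a t‖ ^ 2 + Fintype.card α * ∑ b, ‖B b t‖ ^ 2) := by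
            refine Finset.sum_le_sum fun t _ => ?_
            refine le_of_eq_of_le ?_
              (sum_norm_averages_sub_sq_le (fun a => A a t) (fun b => B b t))
            refine Finset.sum_congr rfl fun w _ => ?_
            rw [hm]
            simp only [Pi.add_apply]
            congr 2
            ring
        _ = Fintype.card β * ∑ a, ∑ t, ‖A a t‖ ^ 2 + Fintype.card α * ∑ b, ∑ t, ‖B b t‖ ^ 2 := by
            rw [Finset.sum_add_distrib, ← Finset.mul_sum, ← Finset.mul_sum, Finset.sum_comm,
              Finset.sum_comm (s := Finset.univ (α := τ)) (t := Finset.univ (α := β))]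
        _ ≤ Fintype.card β * ∑ a : α, p + Fintype.card α * ∑ b : β, q := by
            gcongr with a _ b _
            · exact hA a
            · exact hB b
        _ = Fintype.card (α × β) * (p + q) := by
            simp
            ring
  set P : (τ → ℂ) → α × β → ℝ := fun z' w => (noiseLaw τ).real {z | sim z' (m w + z) = w} with hP
  have hPint : ∀ w, Integrable (fun z' => P z' w) (noiseLaw τ) ∧ ∫ z', P z' w ∂noiseLaw τ =
      ((noiseLaw τ).prod (noiseLaw τ)).real {x | sim x.2 (m w + x.1) = w} := fun w => by
    have hmeas : Measurable fun z' => P z' w :=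
      (measurable_measure_prodMk_right (hsub w)).ennreal_toReal
    refine ⟨Integrable.of_bound hmeas.aestronglyMeasurable 1 (ae_of_all _ fun z' => ?_), ?_⟩
    · rw [Real.norm_of_nonneg measureReal_nonneg]
      exact measureReal_le_one
    · rw [measureReal_def, Measure.prod_apply_symm (hsub w), ← integral_toReal]
      · rfl
      · exact (measurable_measure_prodMk_right (hsub w)).aemeasurable
      · exact ae_of_all _ fun z' => measure_lt_top _ _
  have hlow : ∀ w, 1 - signalError φ (A w.1 + B w.2 + C) w.1 -
      signalError ψ (k * B w.2 + A' w.1) w.2 ≤ ∫ z', P z' w ∂noiseLaw τ := fun w => by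
    rw [(hPint w).2]
    have h1 : signalError φ (A w.1 + B w.2 + C) w.1 =
        ((noiseLaw τ).prod (noiseLaw τ)).real {x | φ (m w + x.1) ≠ w.1} := by
      have : {x : (τ → ℂ) × (τ → ℂ) | φ (m w + x.1) ≠ w.1} =
          {z | φ (m w + z) ≠ w.1} ×ˢ Set.univ := by
        ext x
        simp
      rw [this, measureReal_prod_prod, probReal_univ, mul_one]
      rfl
    have h2 : signalError ψ (k * B w.2 + A' w.1) w.2 = ((noiseLaw τ).prod (noiseLaw τ)).real
        {x | ψ (k * B w.2 + A' w.1 + (k * x.1 + s * x.2)) ≠ w.2} := by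
      have h := (measurePreserving_combination_noiseLaw k s hks).measureReal_preimage
        (s := {z | ψ (k * B w.2 + A' w.1 + z) ≠ w.2})
        ((measurable_const_add (k * B w.2 + A' w.1)) (hψ w.2).compl).nullMeasurableSet
      exact h.symm
    have h3 := probReal_compl_eq_one_sub (μ := (noiseLaw τ).prod (noiseLaw τ)) (hsub w)
    -- If `φ` decodes correctly, the simulated output is exactly a noisy output of the second
    -- receiver. Hence the simulation fails only if `φ` or `ψ` errs.
    have h4 : {x : (τ → ℂ) × (τ → ℂ) | sim x.2 (m w + x.1) = w}ᶜ ⊆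
        {x | φ (m w + x.1) ≠ w.1} ∪ {x | ψ (k * B w.2 + A' w.1 + (k * x.1 + s * x.2)) ≠ w.2} := by
      intro x hx
      by_contra hx'
      simp only [Set.mem_union, Set.mem_ofPred_eq, not_or, not_not] at hx'
      apply hx
      rw [Set.mem_ofPred_eq, hsim, Prod.ext_iff]
      refine ⟨hx'.1, ?_⟩
      simp only
      rw [hx'.1, ← hx'.2, hm]
      congr 1
      ring
    have h5 := (measureReal_mono (μ := (noiseLaw τ).prod (noiseLaw τ)) h4).trans
      (measureReal_union_le _ _)
    rw [h1, h2]
    linarith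
  calc _ ≤ (∑ w, ∫ z', P z' w ∂noiseLaw τ) * Real.log (Fintype.card α * Fintype.card β) := by
        refine mul_le_mul_of_nonneg_right (Finset.sum_le_sum fun w _ => hlow w) (Real.log_nonneg ?_)
        nlinarith
    _ = ∫ z', (∑ w, P z' w) * Real.log (Fintype.card α * Fintype.card β) ∂noiseLaw τ := by
        rw [integral_mul_const, integral_finsetSum _ fun w _ => (hPint w).1]
    _ ≤ ∫ _, Fintype.card α * Fintype.card β * (Fintype.card τ * Real.log v + Real.log 2)
          ∂noiseLaw τ :=
        integral_mono ((integrable_finsetSum _ fun w _ => (hPint w).1).mul_const _)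
          (integrable_const _) hconv
    _ = _ := by simp

end TwoUser

/-! ### Resampling one coordinate of a message tuple. -/

section Update

variable {ι : Type*} [Fintype ι] [DecidableEq ι] {X : ι → Type*}

lemma sum_apply_update {E : Type*} [AddCommGroup E] (f : ∀ l, X l → E) (w : ∀ l, X l) (i : ι)
    (a : X i) :
    ∑ l, f l (Function.update w i a l) = ∑ l, f l (w l) - f i (w i) + f i a := by
  rw [← Finset.add_sum_erase _ _ (Finset.mem_univ i),
    ← Finset.add_sum_erase _ (fun l => f l (w l)) (Finset.mem_univ i), Function.update_self]
  have : ∑ l ∈ Finset.univ.erase i, f l (Function.update w i a l) =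
      ∑ l ∈ Finset.univ.erase i, f l (w l) :=
    Finset.sum_congr rfl fun l hl => by rw [Function.update_of_ne (Finset.ne_of_mem_erase hl)]
  rw [this]
  abel

/-- Exchanging `w i` with `a` is an involution on pairs `(w, a)`, after which the summand no longer
depends on the second entry. -/
lemma sum_sum_update [∀ l, Fintype (X l)] (F : (∀ l, X l) → ℝ) (i : ι) :
    ∑ w, ∑ a, F (Function.update w i a) = Fintype.card (X i) * ∑ w, F w := by
  have hinv : Function.Involutive
      (fun p : (∀ l, X l) × X i => (Function.update p.1 i p.2, p.1 i)) := fun p => by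
    simp
  rw [← Fintype.sum_prod_type' fun w a => F (Function.update w i a),
    ← Equiv.sum_comp hinv.toPerm, Fintype.sum_prod_type]
  simp [Finset.mul_sum]

end Update

/-! ### Reduction of the network to fixed phases and two users. -/

instance : IsProbabilityMeasure uniformPhase := by
  refine cond_isProbabilityMeasure_of_finite ?_ ?_
  · simp [Real.pi_pos]
  · exact measure_Icc_lt_top.ne

variable {n T : ℕ} {M : Fin n → ℕ}

/-- The joint law of the phases. -/
abbrev phaseLaw (n T : ℕ) : Measure (Phases n T) :=
  Measure.pi fun _ => Measure.pi fun _ => Measure.pi fun _ => uniformPhase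

/-- The contribution of transmitter `l` to the signal at receiver `j` when it sends `b`. -/
def contribution (g : Fin n → Fin n → ℝ) (c : Code n T M) (θ : Phases n T) (j l : Fin n)
    (b : Fin (M l)) : Fin T → ℂ :=
  fun t => Complex.exp (Complex.I * (θ t l j : ℂ)) * (Real.sqrt (g l j) : ℂ) * c.enc l b θ t

/-- The noiseless signal at receiver `j`. -/
def cleanSignal (g : Fin n → Fin n → ℝ) (c : Code n T M) (w : (i : Fin n) → Fin (M i))
    (θ : Phases n T) (j : Fin n) : Fin T → ℂ :=
  ∑ l, contribution g c θ j l (w l)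

lemma received_eq (g : Fin n → Fin n → ℝ) (c : Code n T M) (w : (i : Fin n) → Fin (M i))
    (θ : Phases n T) (z : Noise n T) (j : Fin n) :
    received g c w θ z j = cleanSignal g c w θ j + z j := by
  ext t
  simp [received, cleanSignal, contribution]

lemma measurable_cleanSignal (g : Fin n → Fin n → ℝ) (c : Code n T M)
    (w : (i : Fin n) → Fin (M i)) (j : Fin n) : Measurable fun θ => cleanSignal g c w θ j := by
  unfold cleanSignal contribution
  refine Finset.measurable_fun_sum _ fun l _ => measurable_pi_lambda _ fun t => ?_
  have h : Measurable fun θ => c.enc l (w l) θ t :=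
    (measurable_pi_apply t).comp (c.measurable_enc l (w l))
  fun_prop

/-- The error probability of receiver `j` given the messages and the phases. -/
def condError (g : Fin n → Fin n → ℝ) (c : Code n T M) (j : Fin n) (w : (i : Fin n) → Fin (M i))
    (θ : Phases n T) : ℝ :=
  signalError (fun y => c.dec j y θ) (cleanSignal g c w θ j) (w j)

lemma measurableSet_error (g : Fin n → Fin n → ℝ) (c : Code n T M) (j : Fin n)
    (w : (i : Fin n) → Fin (M i)) :
    MeasurableSet {p : Phases n T × (Fin T → ℂ) |
      c.dec j (cleanSignal g c w p.1 j + p.2) p.1 ≠ w j} := by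
  have h := measurable_cleanSignal g c w j
  have h' : Measurable fun p : Phases n T × (Fin T → ℂ) =>
      (cleanSignal g c w p.1 j + p.2, p.1) := by fun_prop
  exact ((c.measurable_dec j).comp h') (measurableSet_singleton (w j)).compl

lemma measurable_condError (g : Fin n → Fin n → ℝ) (c : Code n T M) (j : Fin n)
    (w : (i : Fin n) → Fin (M i)) : Measurable (condError g c j w) :=
  (measurable_measure_prodMk_left (measurableSet_error g c j w)).ennreal_toReal

lemma integrable_condError (g : Fin n → Fin n → ℝ) (c : Code n T M) (j : Fin n)
    (w : (i : Fin n) → Fin (M i)) : Integrable (condError g c j w) (phaseLaw n T) := by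
  refine Integrable.of_bound (measurable_condError g c j w).aestronglyMeasurable 1
    (ae_of_all _ fun θ => ?_)
  rw [condError, signalError, Real.norm_of_nonneg measureReal_nonneg]
  exact measureReal_le_one

/-- The event involves only the phases and the noise of receiver `j`, so the channel law may be
replaced by that marginal, and the noise is integrated first. -/
lemma channelLaw_real_error (g : Fin n → Fin n → ℝ) (c : Code n T M) (j : Fin n)
    (w : (i : Fin n) → Fin (M i)) :
    (channelLaw n T).real {p | c.dec j (received g c w p.1 p.2 j) p.1 ≠ w j} =
      ∫ θ, condError g c j w θ ∂phaseLaw n T := by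
  have hmp : MeasurePreserving (Prod.map id (Function.eval j)) (channelLaw n T)
      ((phaseLaw n T).prod (noiseLaw (Fin T))) :=
    (MeasurePreserving.id _).prod (measurePreserving_eval (fun _ => noiseLaw (Fin T)) j)
  have h := hmp.measureReal_preimage (measurableSet_error g c j w).nullMeasurableSet
  simp_rw [received_eq]
  refine h.trans ?_
  rw [measureReal_def, Measure.prod_apply (measurableSet_error g c j w), ← integral_toReal]
  · rfl
  · exact (measurable_measure_prodMk_left (measurableSet_error g c j w)).aemeasurable
  · exact ae_of_all _ fun θ => measure_lt_top _ _

lemma errorProb_eq (g : Fin n → Fin n → ℝ) (c : Code n T M) (j : Fin n) :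
    errorProb g c j = (∫ θ, ∑ w, condError g c j w θ ∂phaseLaw n T) /
      (Fintype.card ((i : Fin n) → Fin (M i)) : ℝ) := by
  rw [errorProb, integral_finsetSum _ fun w _ => integrable_condError g c j w]
  simp_rw [channelLaw_real_error]

lemma sum_norm_contribution_sq_le (g : Fin n → Fin n → ℝ) (c : Code n T M) (hT : 0 < T)
    (θ : Phases n T) (j l : Fin n) (hg : 0 ≤ g l j) (b : Fin (M l)) :
    ∑ t, ‖contribution g c θ j l b t‖ ^ 2 ≤ g l j * T := by
  have hT' : (0 : ℝ) < T := by exact_mod_cast hT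
  have hp := c.power l b θ
  rw [one_div, inv_mul_le_iff₀ hT', mul_one] at hp
  have h : ∀ t, ‖contribution g c θ j l b t‖ ^ 2 = g l j * ‖c.enc l b θ t‖ ^ 2 := fun t => by
    rw [contribution, norm_mul, norm_mul, mul_comm Complex.I, Complex.norm_exp_ofReal_mul_I,
      Complex.norm_real, Real.norm_of_nonneg (Real.sqrt_nonneg _), one_mul, mul_pow,
      Real.sq_sqrt hg]
  simp_rw [h]
  rw [← Finset.mul_sum]
  exact mul_le_mul_of_nonneg_left hp hg

lemma cleanSignal_update (g : Fin n → Fin n → ℝ) (c : Code n T M) (θ : Phases n T)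
    (w : (i : Fin n) → Fin (M i)) {i j : Fin n} (hij : i ≠ j) (a : Fin (M i)) (b : Fin (M j))
    (l : Fin n) :
    cleanSignal g c (Function.update (Function.update w i a) j b) θ l =
      contribution g c θ l i a + contribution g c θ l j b +
        (cleanSignal g c w θ l - contribution g c θ l i (w i) - contribution g c θ l j (w j)) := by
  unfold cleanSignal
  rw [sum_apply_update (fun l' => contribution g c θ l l'),
    sum_apply_update (fun l' => contribution g c θ l l'), Function.update_of_ne hij.symm]
  abel

/-- The sum-rate bound for a bottleneck link, for fixed phases and fixed messages of all users
other than `i` and `j`. -/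
lemma sum_condError_update_le (g : Fin n → Fin n → ℝ) (c : Code n T M) (hT : 0 < T)
    (hM : ∀ l, Nonempty (Fin (M l))) {i j : Fin n} (hij : i ≠ j) (hii : 0 ≤ g i i)
    (hji : 0 ≤ g j i) (hle : g j j ≤ g j i) (θ : Phases n T) (w : (i : Fin n) → Fin (M i)) :
    (∑ a, ∑ b, (1 - condError g c i (Function.update (Function.update w i a) j b) θ -
        condError g c j (Function.update (Function.update w i a) j b) θ)) *
        Real.log (M i * M j) ≤
      M i * M j * (T * Real.log (1 + g i i + g j i) + Real.log 2) := by
  set v : ℝ≥0 := ⟨1 + g i i + g j i, by positivity⟩ with hv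
  have hv0 : v ≠ 0 := by
    rw [← NNReal.coe_ne_zero]
    change 1 + g i i + g j i ≠ 0
    positivity
  -- The factor undoes the phase and gain of the link from `j` to `i` and applies those of the link
  -- from `j` to `j`.
  set k : Fin T → ℂ := fun t => Complex.exp (Complex.I * (θ t j j : ℂ)) *
    Complex.exp (-(Complex.I * (θ t j i : ℂ))) * ((√(g j j) / √(g j i) : ℝ) : ℂ) with hk
  have hk1 : ∀ t, ‖k t‖ ≤ 1 := fun t => by
    have h1 : -(Complex.I * (θ t j i : ℂ)) = ((-θ t j i : ℝ) : ℂ) * Complex.I := by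
      push_cast
      ring
    rw [hk]
    simp only
    rw [norm_mul, norm_mul, mul_comm Complex.I, Complex.norm_exp_ofReal_mul_I, h1,
      Complex.norm_exp_ofReal_mul_I, Complex.norm_real, Real.norm_of_nonneg (by positivity),
      one_mul, one_mul]
    exact div_le_one_of_le₀ (Real.sqrt_le_sqrt hle) (Real.sqrt_nonneg _)
  have hkB : ∀ b, k * contribution g c θ i j b = contribution g c θ j j b := fun b => by
    ext t
    rw [Pi.mul_apply, contribution, contribution, hk]
    have h1 : Complex.exp (-(Complex.I * (θ t j i : ℂ))) * Complex.exp (Complex.I * (θ t j i : ℂ))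
        = 1 := by
      rw [← Complex.exp_add, neg_add_cancel, Complex.exp_zero]
    have h2 : ((√(g j j) / √(g j i) : ℝ) : ℂ) * (√(g j i) : ℂ) = (√(g j j) : ℂ) := by
      rw [← Complex.ofReal_mul]
      congr 1
      -- If `√(g j i) = 0`, the quotient is zero by convention, which is the right value since `√(g
      -- j j)` then vanishes too.
      refine div_mul_cancel_of_imp fun h => ?_
      exact le_antisymm (h ▸ Real.sqrt_le_sqrt hle) (Real.sqrt_nonneg _)
    linear_combination (Complex.exp (Complex.I * (θ t j j : ℂ)) * c.enc j b θ t) *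
      (((√(g j j) / √(g j i) : ℝ) : ℂ) * (√(g j i) : ℂ) * h1 + h2)
  have hdec : ∀ l, Measurable fun y => c.dec l y θ := fun l =>
    (c.measurable_dec l).comp (show Measurable fun y : Fin T → ℂ => (y, θ) by fun_prop)
  -- The signals of the other users are constants here. At receiver `i` they form `C`; at receiver
  -- `j` they are absorbed into `A'`.
  have h := sum_two_user_le hv0 (fun a => contribution g c θ i i a)
    (fun a => contribution g c θ j i a + (cleanSignal g c w θ j - contribution g c θ j i (w i) -
      contribution g c θ j j (w j))) (fun b => contribution g c θ i j b)
    (cleanSignal g c w θ i - contribution g c θ i i (w i) - contribution g c θ i j (w j)) k hk1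
    (p := g i i * T) (q := g j i * T)
    (fun a => sum_norm_contribution_sq_le g c hT θ i i hii a)
    (fun b => sum_norm_contribution_sq_le g c hT θ i j hji b)
    (by
      rw [Fintype.card_fin]
      change (T : ℝ) + (g i i * T + g j i * T) ≤ (1 + g i i + g j i) * T
      linarith)
    (fun y => c.dec i y θ) (fun a => hdec i (measurableSet_singleton a))
    (fun y => c.dec j y θ) (fun b => hdec j (measurableSet_singleton b))
  simp only [Fintype.card_fin] at h
  rw [Fintype.sum_prod_type] at h
  refine le_of_eq_of_le ?_ h
  congr 1
  refine Finset.sum_congr rfl fun a _ => Finset.sum_congr rfl fun b _ => ?_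
  simp only [condError, cleanSignal_update g c θ w hij, hkB]
  rw [Function.update_of_ne hij, Function.update_self, Function.update_self]
  congr 2
  abel

/-- The sum-rate bound for a bottleneck link, for a single code. -/
theorem one_sub_errorProb_mul_log_le (g : Fin n → Fin n → ℝ) (c : Code n T M) (hT : 0 < T)
    (hM : ∀ l, Nonempty (Fin (M l))) {i j : Fin n} (hij : i ≠ j) (hii : 0 ≤ g i i)
    (hji : 0 ≤ g j i) (hle : g j j ≤ g j i) :
    (1 - errorProb g c i - errorProb g c j) * Real.log (M i * M j) ≤
      T * Real.log (1 + g i i + g j i) + Real.log 2 := by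
  set K : ℝ := T * Real.log (1 + g i i + g j i) + Real.log 2 with hK
  have hMpos : ∀ l, (0 : ℝ) < M l := fun l => by
    exact_mod_cast Fin.pos_iff_nonempty.2 (hM l)
  set N : ℝ := (Fintype.card ((l : Fin n) → Fin (M l)) : ℝ) with hN
  have hcard : 0 < N := Nat.cast_pos.2 Fintype.card_pos
  have hpt : ∀ θ, (N - ∑ w, condError g c i w θ - ∑ w, condError g c j w θ) *
      Real.log (M i * M j) ≤ N * K := fun θ => by
    set F : ((l : Fin n) → Fin (M l)) → ℝ :=
      fun w => 1 - condError g c i w θ - condError g c j w θ with hF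
    have h1 : ∑ w, ∑ a, ∑ b, F (Function.update (Function.update w i a) j b) =
        M i * M j * ∑ w, F w := by
      -- Summing the two-user bound over all tuples `w` counts every tuple `M i * M j` times; the
      -- factor cancels below.
      rw [sum_sum_update (fun w => ∑ b, F (Function.update w j b)) i, sum_sum_update F j]
      simp only [Fintype.card_fin]
      ring
    have h2 := Finset.sum_le_sum fun w (_ : w ∈ Finset.univ) =>
      sum_condError_update_le g c hT hM hij hii hji hle θ w
    rw [← Finset.sum_mul, Finset.sum_const, Finset.card_univ, nsmul_eq_mul] at h2
    change (∑ w, ∑ a, ∑ b, F (Function.update (Function.update w i a) j b)) * _ ≤ _ at h2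
    rw [h1] at h2
    have h3 : ∑ w, F w =
        N - ∑ w, condError g c i w θ - ∑ w, condError g c j w θ := by
      simp [hF, hN, Finset.sum_sub_distrib]
    rw [← h3]
    refine le_of_mul_le_mul_left ?_ (mul_pos (hMpos i) (hMpos j))
    linarith
  have hi : ∀ l, Integrable (fun θ => ∑ w, condError g c l w θ) (phaseLaw n T) := fun l =>
    integrable_finsetSum _ fun w _ => integrable_condError g c l w
  have hc : Integrable (fun _ : Phases n T => N) (phaseLaw n T) :=
    integrable_const _
  have hci : Integrable (fun θ => N - ∑ w, condError g c i w θ)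
    (phaseLaw n T) := hc.sub (hi i)
  have h := integral_mono ((hci.sub (hi j)).mul_const _) (integrable_const _) hpt
  rw [integral_mul_const, integral_sub' hci (hi j), integral_sub hc (hi i)] at h
  simp only [integral_const, probReal_univ, one_smul] at h
  rw [errorProb_eq, errorProb_eq, ← hN]
  refine le_of_mul_le_mul_left (le_of_eq_of_le ?_ h) hcard
  field_simp

/-! ### Long block lengths, vanishing error, and the bound by link strengths. -/

lemma rate_le_of_achievable {g : Fin n → Fin n → ℝ} {r : Fin n → ℝ} (hr : Achievable g r)
    {i j : Fin n} (hij : i ≠ j) (hii : 0 ≤ g i i) (hji : 0 ≤ g j i) (hle : g j j ≤ g j i) :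
    r i + r j ≤ Real.log (1 + g i i + g j i) := by
  set L := Real.log (1 + g i i + g j i) with hL
  have hL0 : 0 ≤ L := Real.log_nonneg (by linarith)
  -- For fixed `δ` the term `log 2 / T` vanishes as `T` grows; only afterwards does `δ` tend to
  -- zero. The condition `2 * δ < 1` keeps the factor positive, so the inequalities `T * r l ≤ log
  -- (M l)` may be multiplied by it.
  have key : ∀ δ > (0 : ℝ), 2 * δ < 1 → (1 - 2 * δ) * (r i + r j) ≤ L := by
    intro δ hδ hδ1
    have hlim : Tendsto (fun T : ℕ => L + Real.log 2 / T) atTop (nhds (L + 0)) :=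
      tendsto_const_nhds.add (tendsto_const_div_atTop_nhds_zero_nat _)
    rw [add_zero] at hlim
    refine ge_of_tendsto hlim ?_
    filter_upwards [hr δ hδ, eventually_gt_atTop 0] with T ⟨M, c, hM, he⟩ hT
    have hT' : (0 : ℝ) < T := by exact_mod_cast hT
    have hMpos : ∀ l, (0 : ℝ) < M l := fun l => (Real.exp_pos _).trans_le (hM l)
    have hne : ∀ l, Nonempty (Fin (M l)) := fun l =>
      Fin.pos_iff_nonempty.1 (by exact_mod_cast hMpos l)
    have hlog : ∀ l, T * r l ≤ Real.log (M l) := fun l => by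
      rw [Real.le_log_iff_exp_le (hMpos l)]
      exact hM l
    have hlog0 : ∀ l, 0 ≤ Real.log (M l) := fun l => Real.log_natCast_nonneg _
    have h := one_sub_errorProb_mul_log_le g c hT hne hij hii hji hle
    rw [Real.log_mul (hMpos i).ne' (hMpos j).ne'] at h
    have h1 : (1 - 2 * δ) * (Real.log (M i) + Real.log (M j)) ≤
        (1 - errorProb g c i - errorProb g c j) * (Real.log (M i) + Real.log (M j)) :=
      mul_le_mul_of_nonneg_right (by linarith [he i, he j]) (by linarith [hlog0 i, hlog0 j])
    have h2 : (1 - 2 * δ) * (T * r i + T * r j) ≤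
        (1 - 2 * δ) * (Real.log (M i) + Real.log (M j)) :=
      mul_le_mul_of_nonneg_left (by linarith [hlog i, hlog j]) (by linarith)
    refine le_of_mul_le_mul_left ?_ hT'
    rw [mul_add (T : ℝ) L, mul_div_cancel₀ _ hT'.ne']
    linarith
  have hlim : Tendsto (fun δ : ℝ => (1 - 2 * δ) * (r i + r j)) (nhdsWithin 0 (Set.Ioi 0))
      (nhds ((1 - 2 * 0) * (r i + r j))) :=
    (Continuous.tendsto (by fun_prop) 0).mono_left nhdsWithin_le_nhds
  rw [mul_zero, sub_zero, one_mul] at hlim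
  refine le_of_tendsto hlim ?_
  filter_upwards [Ioo_mem_nhdsGT (show (0 : ℝ) < 1 / 2 by norm_num)] with δ hδ
  exact key δ hδ.1 (by linarith [hδ.2])

lemma halfLog_le_halfLog_iff {x y : ℝ} (hx : 0 ≤ x) (hy : 0 ≤ y) :
    halfLog x ≤ halfLog y ↔ x ≤ y := by
  unfold halfLog
  rw [mul_le_mul_iff_right₀ (by norm_num), Real.log_le_log_iff (by linarith) (by linarith)]
  constructor <;> intro h <;> linarith

lemma log_one_add_add_le_two_mul_max {x y : ℝ} (hx : 0 ≤ x) (hy : 0 ≤ y) :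
    Real.log (1 + x + y) ≤ 2 * max (halfLog x) (halfLog y) := by
  unfold halfLog
  rcases le_total x y with h | h
  · have := Real.log_le_log (by linarith) (show 1 + x + y ≤ 1 + 2 * y by linarith)
    have := le_max_right (1 / 2 * Real.log (1 + 2 * x)) (1 / 2 * Real.log (1 + 2 * y))
    linarith
  · have := Real.log_le_log (by linarith) (show 1 + x + y ≤ 1 + 2 * x by linarith)
    have := le_max_left (1 / 2 * Real.log (1 + 2 * x)) (1 / 2 * Real.log (1 + 2 * y))
    linarith

end GaussianInterference

end

open GaussianInterference in
theorem lemma4 {n d : ℕ}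
    (PT PR : Measure (EuclideanSpace ℝ (Fin d))) [IsProbabilityMeasure PT] [IsProbabilityMeasure PR]
    (a : ℝ → ℝ) (ha : ∀ ρ, 0 ≤ ρ → 0 ≤ a ρ)
    (hE : Integrable (fun p : EuclideanSpace ℝ (Fin d) × EuclideanSpace ℝ (Fin d) =>
      halfLog (a (dist p.1 p.2))) (PT.prod PR))
    (tx rx : Fin n → EuclideanSpace ℝ (Fin d)) (ε : ℝ) (i j : Fin n)
    (hij : IsBottleneck (strength a tx rx) (meanStrength a PT PR) ε i j)
    (r : Fin n → ℝ) (hr : Achievable (gain a tx rx) r) :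
    r i + r j ≤ 2 * meanStrength a PT PR + ε := by
  have hg : ∀ k l, 0 ≤ gain a tx rx k l := fun k l => ha _ dist_nonneg
  have hle := (halfLog_le_halfLog_iff (hg j j) (hg j i)).1 hij.direct_le_cross
  have h1 := rate_le_of_achievable hr hij.ne (hg i i) (hg j i) hle
  have h2 := log_one_add_add_le_two_mul_max (hg i i) (hg j i)
  have h3 := max_le hij.direct_le hij.cross_le
  unfold strength at h3
  linarith
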